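/- Let $X$ be a real reflexive Banach space and $Z$ a real Hausdorff locally convex topological vector space. Let $C\subseteq Z$ be a convex pointed cone (that is, $tc\in C$ for all $c\in C$, $t\ge 0$; $C+C=C$; $C\cap(-C)=\{0\}$) with nonempty interior, and let $K\subseteq X$ be nonempty, convex and closed. Let $D\subseteq K$ be self segment-dense in $K$ in the weak topology of $X$, i.e. $D$ is weakly dense in $K$ and, for all $x,y\in D$, the set $[x,y]\cap D$ is weakly dense in the segment $[x,y]$. Let $F:K\to Z$ satisfy: (i) $F$ is strongly $C$-lower semicontinuous on $K$, i.e. $-F$ is strongly $C$-upper semicontinuous at every $x\in K$; (ii) $F$ is strongly $C$-upper semicontinuous on $K\setminus D$, i.e. for every $x\in K\setminus D$ and every $k\in C\setminus\{0\}$ there is a neighbourhood $U$ of $x$ such that $F(u)\in F(x)+k-(C\setminus\{0\})$ for all $u\in U\cap K$; (iii) $F$ is $C$-convex on $D$, i.e. $\sum_{i=1}^n\lambda_iF(x_i)-F\big(\sum_{i=1}^n\lambda_ix_i\big)\in C$ whenever $n\in\mathbb N$, $x_1,\dots,x_n\in D$, $\lambda_i\ge0$, $\sum_{i=1}^n\lambda_i=1$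 and $\sum_{i=1}^n\lambda_ix_i\in D$; (iv) there is $r>0$ such that $\{x\in K:\|x\|\le r\}\ne\emptyset$ and, for every $x\in K$ with $\|x\|\le r$, there exists $y_0\in D$ with $\|y_0\|<r$ and $F(y_0)-F(x)\in -C$. Here neighbourhoods in (i) and (ii) are taken in the norm topology of $X$ (so the result holds in particular when (i) and (ii) hold with weak neighbourhoods). Then $F$ has an efficient point: there is $x_0\in K$ with $F(y)-F(x_0)\notin -C\setminus\{0\}$ for all $y\in K$. -/

import Mathlib

open Set Topology Pointwise

/-- `X` is a reflexive Banach space: complete, with surjective canonical map into the bidual. -/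
def IsReflexiveBanach (X : Type*) [NormedAddCommGroup X] [NormedSpace ℝ X] : Prop :=
  CompleteSpace X ∧ Function.Surjective (NormedSpace.inclusionInDoubleDual ℝ X)

/-- `C` is a convex pointed cone: `t • c ∈ C` for `c ∈ C` and `t ≥ 0`, `C + C = C`, and
`C ∩ (-C) = {0}`. -/
structure IsConvexPointedCone {Z : Type*} [AddCommGroup Z] [Module ℝ Z] (C : Set Z) : Prop where
  smul_mem : ∀ t : ℝ, 0 ≤ t → ∀ c ∈ C, t • c ∈ C
  add_eq : C + C = C
  inter_neg_eq : C ∩ (-C) = {0}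

/-- `U` is self segment-dense in the convex set `V`: `U ⊆ V`, `U` is dense in `V`, and
`[x, y] ∩ U` is dense in `[x, y]` for all `x, y ∈ U`. -/
structure IsSelfSegmentDense {E : Type*} [AddCommGroup E] [Module ℝ E] [TopologicalSpace E]
    (U V : Set E) : Prop where
  convex : Convex ℝ V
  subset : U ⊆ V
  dense : V ⊆ closure U
  segment_dense : ∀ x ∈ U, ∀ y ∈ U, segment ℝ x y ⊆ closure (segment ℝ x y ∩ U)

/-- The map `F : K → Z` is strongly `C`-upper semicontinuous at `x`: for every `k ∈ C \ {0}` there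
is a neighbourhood `U` of `x` with `F u ∈ F x + k - (C \ {0})` for all `u ∈ U ∩ K`.
Only the values of `F` on `K` matter when `x ∈ K`. -/
def StronglyUSCAt {X Z : Type*} [TopologicalSpace X] [AddCommGroup Z]
    (C : Set Z) (K : Set X) (F : X → Z) (x : X) : Prop :=
  ∀ k ∈ C \ {0}, ∃ U ∈ 𝓝 x, ∀ u ∈ U ∩ K, F u ∈ {F x + k} - (C \ {0})

/-- The map `F : K → Z` is strongly `C`-lower semicontinuous at `x`: `-F` is strongly `C`-upper
semicontinuous at `x`. -/
def StronglyLSCAt {X Z : Type*} [TopologicalSpace X] [AddCommGroup Z]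
    (C : Set Z) (K : Set X) (F : X → Z) (x : X) : Prop :=
  StronglyUSCAt C K (fun u => -F u) x

/-- `F` is `C`-convex on the (not necessarily convex) set `D`: Jensen's inequality for the order
`z₁ ≤ z₂ ↔ z₂ - z₁ ∈ C` holds for every convex combination of points of `D` that lies in `D`. -/
def ConeConvexOn {X Z : Type*} [AddCommGroup X] [Module ℝ X] [AddCommGroup Z] [Module ℝ Z]
    (C : Set Z) (D : Set X) (F : X → Z) : Prop :=
  ∀ (n : ℕ) (x : Fin n → X) (w : Fin n → ℝ), (∀ i, x i ∈ D) → (∀ i, 0 ≤ w i) →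
    ∑ i, w i = 1 → ∑ i, w i • x i ∈ D →
    ∑ i, w i • F (x i) - F (∑ i, w i • x i) ∈ C

/-- `x₀ ∈ K` is an efficient point of `F : K → Z`: `F y - F x₀ ∉ -C \ {0}` for all `y ∈ K`. -/
def IsEfficientPoint {X Z : Type*} [AddCommGroup Z]
    (C : Set Z) (K : Set X) (F : X → Z) (x₀ : X) : Prop :=
  x₀ ∈ K ∧ ∀ y ∈ K, F y - F x₀ ∉ (-C) \ {0}

section WeakTopology

variable {X : Type*} [NormedAddCommGroup X] [NormedSpace ℝ X]

/-! Order `Z` by `C`. As `C` need not be closed, exact sublevel sets are replaced by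
`approxSublevel`, which allows every slack `k ∈ C \ {0}`. These sets are norm closed by lower
semicontinuity, and convex because Jensen on `D` passes to `K` through density and upper
semicontinuity off `D`. Cut by a closed ball they are weakly compact, so Zorn's lemma gives an
efficient point on the ball. Coercivity trades it for a point of `D` inside the open ball with the
same value, and convexity along segments turns local efficiency there into global efficiency. -/

theorem t2Space_weakSpace : T2Space (WeakSpace ℝ X) :=
  (NormedSpace.isEmbedding_inclusionInDoubleDualWeak ℝ X).t2Space

/-- Mazur's theorem. -/
theorem Convex.isClosed_image_toWeakSpace {S : Set X} (hS : Convex ℝ S) (hc : IsClosed S) :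
    IsClosed (toWeakSpace ℝ X '' S) := by
  rw [← closure_eq_iff_isClosed, ← hS.toWeakSpace_closure ℝ, hc.closure_eq]

/-- In a reflexive space, bounded closed convex sets are weakly compact. -/
theorem IsReflexiveBanach.isCompact_image_toWeakSpace (hX : IsReflexiveBanach X) {S : Set X}
    (hS : Convex ℝ S) (hc : IsClosed S) (hb : Bornology.IsBounded S) :
    IsCompact (toWeakSpace ℝ X '' S) := by
  rw [← (hS.isClosed_image_toWeakSpace hc).closure_eq]
  refine NormedSpace.isCompact_closure_of_isBounded ℝ X _ ?_ fun f _ => ?_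
  · rwa [preimage_image_eq _ (toWeakSpace ℝ X).injective]
  · obtain ⟨x, hx⟩ := hX.2 (WeakDual.toStrongDual f)
    exact ⟨toWeakSpace ℝ X x, DFunLike.ext _ _ fun g =>
      DFunLike.congr_fun hx g⟩

/-- In a reflexive space, a directed family of nonempty bounded closed convex sets has nonempty
intersection. -/
theorem IsReflexiveBanach.nonempty_iInter_of_directed (hX : IsReflexiveBanach X) {ι : Type*}
    [Nonempty ι] (t : ι → Set X) (hd : Directed (· ⊇ ·) t) (hne : ∀ i, (t i).Nonempty)
    (hconv : ∀ i, Convex ℝ (t i)) (hcl : ∀ i, IsClosed (t i))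
    (hb : ∀ i, Bornology.IsBounded (t i)) : (⋂ i, t i).Nonempty := by
  have h := IsCompact.nonempty_iInter_of_directed_nonempty_isCompact_isClosed
    (fun i => toWeakSpace ℝ X '' t i) (fun i j => ?_) (fun i => (hne i).image _)
    (fun i => hX.isCompact_image_toWeakSpace (hconv i) (hcl i) (hb i))
    (fun i => (hconv i).isClosed_image_toWeakSpace (hcl i))
  · rwa [← image_iInter (toWeakSpace ℝ X).bijective, image_nonempty] at h
  · obtain ⟨k, hk⟩ := hd i j
    exact ⟨k, image_mono hk.1, image_mono hk.2⟩

/-- Weak and norm closures agree for subsets of a norm-compact set. -/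
theorem IsCompact.closure_image_toWeakSpace_subset {S A : Set X} (hS : IsCompact S) (hA : A ⊆ S) :
    closure (toWeakSpace ℝ X '' A) ⊆ toWeakSpace ℝ X '' closure A := by
  have := t2Space_weakSpace (X := X)
  have hcont : Continuous (toWeakSpace ℝ X) := (toWeakSpaceCLM ℝ X).continuous
  exact closure_minimal (image_mono subset_closure)
    ((hS.of_isClosed_subset isClosed_closure
      (closure_minimal hA hS.isClosed)).image hcont).isClosed

/-- A weakly self segment-dense set is self segment-dense in the norm topology. -/
theorem IsSelfSegmentDense.of_toWeakSpace {D K : Set X}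
    (hD : IsSelfSegmentDense (toWeakSpace ℝ X '' D) (toWeakSpace ℝ X '' K)) :
    IsSelfSegmentDense D K := by
  have inj : Function.Injective (toWeakSpace ℝ X) := (toWeakSpace ℝ X).injective
  have hseg : ∀ x ∈ D, ∀ y ∈ D, segment ℝ x y ⊆ closure (segment ℝ x y ∩ D) := by
    intro x hx y hy
    have h := hD.segment_dense _ (mem_image_of_mem _ hx) _ (mem_image_of_mem _ hy)
    have himg : segment ℝ (toWeakSpace ℝ X x) (toWeakSpace ℝ X y)
        = toWeakSpace ℝ X '' segment ℝ x y :=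
      (image_segment ℝ (toWeakSpace ℝ X).toLinearMap.toAffineMap x y).symm
    have hcomp : IsCompact (segment ℝ x y) := by
      rw [segment_eq_image_lineMap]
      exact isCompact_Icc.image AffineMap.lineMap_continuous
    rw [himg, ← image_inter inj] at h
    exact (image_subset_image_iff inj).1
      (h.trans (hcomp.closure_image_toWeakSpace_subset inter_subset_left))
  -- Segments between points of `D` lie in `closure D`; pass to limits in the endpoints. Mazur then
  -- makes `closure D` weakly closed, so it contains `K`.
  have hconv : Convex ℝ (closure D) := by
    rw [convex_iff_forall_pos]
    intro x hx y hy a b ha hb hab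
    have hmaps : MapsTo (fun p : X × X => a • p.1 + b • p.2) (D ×ˢ D) (closure D) :=
      fun p hp => closure_mono inter_subset_right
        (hseg _ hp.1 _ hp.2 ⟨a, b, ha.le, hb.le, hab, rfl⟩)
    have h := hmaps.closure (by fun_prop)
    rw [closure_prod_eq, closure_closure] at h
    exact h (mk_mem_prod hx hy)
  refine ⟨?_, (image_subset_image_iff inj).1 hD.subset, ?_, hseg⟩
  · have h := hD.convex.is_linear_preimage (toWeakSpace ℝ X).toLinearMap.isLinear
    exact (preimage_image_eq K inj) ▸ h
  · refine (image_subset_image_iff inj).1 (hD.dense.trans ?_)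
    exact closure_minimal (image_mono subset_closure)
      (hconv.isClosed_image_toWeakSpace isClosed_closure)

end WeakTopology

namespace IsConvexPointedCone

variable {Z : Type*} [AddCommGroup Z] [Module ℝ Z] {C : Set Z}

theorem add_mem (hC : IsConvexPointedCone C) {a b : Z} (ha : a ∈ C) (hb : b ∈ C) : a + b ∈ C :=
  hC.add_eq ▸ Set.add_mem_add ha hb

theorem zero_mem (hC : IsConvexPointedCone C) : (0 : Z) ∈ C :=
  (hC.inter_neg_eq.symm ▸ mem_singleton (0 : Z) : (0 : Z) ∈ C ∩ -C).1

theorem eq_zero (hC : IsConvexPointedCone C) {a : Z} (ha : a ∈ C) (hna : -a ∈ C) : a = 0 := by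
  have h : a ∈ C ∩ -C := ⟨ha, hna⟩
  rwa [hC.inter_neg_eq] at h

theorem smul_mem_diff (hC : IsConvexPointedCone C) {t : ℝ} (ht : 0 < t) {a : Z}
    (ha : a ∈ C \ {0}) : t • a ∈ C \ {0} :=
  ⟨hC.smul_mem t ht.le a ha.1, smul_ne_zero ht.ne' ha.2⟩

theorem add_mem_diff (hC : IsConvexPointedCone C) {a b : Z} (ha : a ∈ C) (hb : b ∈ C \ {0}) :
    a + b ∈ C \ {0} := by
  refine ⟨hC.add_mem ha hb.1, fun h => hb.2 (hC.eq_zero hb.1 ?_)⟩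
  rwa [← eq_neg_of_add_eq_zero_left h]

end IsConvexPointedCone

section Semicontinuity

variable {X Z : Type*} [TopologicalSpace X] [AddCommGroup Z] {C : Set Z} {K : Set X} {F : X → Z}
  {x : X}

theorem StronglyUSCAt.eventually (h : StronglyUSCAt C K F x) {k : Z} (hk : k ∈ C \ {0}) :
    ∀ᶠ u in 𝓝 x, u ∈ K → F x + k - F u ∈ C \ {0} := by
  obtain ⟨U, hU, h⟩ := h k hk
  filter_upwards [hU] with u hu huK
  obtain ⟨_, rfl, c, hc, h⟩ := h u ⟨hu, huK⟩
  rw [← h]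
  simpa using hc

theorem StronglyLSCAt.eventually (h : StronglyLSCAt C K F x) {k : Z} (hk : k ∈ C \ {0}) :
    ∀ᶠ u in 𝓝 x, u ∈ K → F u + k - F x ∈ C \ {0} := by
  filter_upwards [StronglyUSCAt.eventually h hk] with u hu huK
  convert hu huK using 1
  abel

end Semicontinuity

/-- The points of `K` at which `F` is bounded above by `a`, up to arbitrarily small elements of the
cone `C`. -/
def approxSublevel {X Z : Type*} [AddCommGroup Z] (C : Set Z) (K : Set X) (F : X → Z) (a : Z) :
    Set X :=
  {x ∈ K | ∀ k ∈ C \ {0}, a - F x + k ∈ C}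

/-- Half of the slack pays for lower semicontinuity at the limit, half for membership of a nearby
point. -/
theorem isClosed_approxSublevel {X Z : Type*} [TopologicalSpace X] [AddCommGroup Z] [Module ℝ Z]
    {C : Set Z} {K : Set X} {F : X → Z} (hC : IsConvexPointedCone C) (hK : IsClosed K) (hlsc : ∀ x ∈ K, StronglyLSCAt C K F x)
    (a : Z) : IsClosed (approxSublevel C K F a) := by
  refine isClosed_of_closure_subset fun x hx => ?_
  have hxK : x ∈ K := closure_minimal (fun _ h => h.1) hK hx
  refine ⟨hxK, fun k hk => ?_⟩
  have hk2 := hC.smul_mem_diff (t := 1 / 2) (by norm_num) hk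
  obtain ⟨u, hu, hua⟩ := mem_closure_iff_nhds.1 hx _ ((hlsc x hxK).eventually hk2)
  convert hC.add_mem (hu hua.1).1 (hua.2 _ hk2) using 1
  module

section ConeConvex

variable {X Z : Type*} [NormedAddCommGroup X] [NormedSpace ℝ X] [AddCommGroup Z] [Module ℝ Z]
  {C : Set Z} {K D : Set X} {F : X → Z}

theorem ConeConvexOn.pair (h : ConeConvexOn C D F) {x y : X} (hx : x ∈ D) (hy : y ∈ D) {a b : ℝ}
    (ha : 0 ≤ a) (hb : 0 ≤ b) (hab : a + b = 1) (hz : a • x + b • y ∈ D) :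
    a • F x + b • F y - F (a • x + b • y) ∈ C := by
  have := h 2 ![x, y] ![a, b] (by simp [Fin.forall_fin_two, hx, hy])
    (by simp [Fin.forall_fin_two, ha, hb]) (by simpa using hab) (by simpa using hz)
  simpa using this

/-- A point of `K` is approximated by points of `D` where `F` is not much larger. -/
theorem exists_mem_inter_sub_mem (hD : IsSelfSegmentDense D K)
    (husc : ∀ x ∈ K \ D, StronglyUSCAt C K F x) {x : X} (hx : x ∈ K) {k : Z} (hk : k ∈ C \ {0})
    {U : Set X} (hU : U ∈ 𝓝 x) : ∃ u ∈ U ∩ D, F x + k - F u ∈ C \ {0} := by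
  by_cases hxD : x ∈ D
  · exact ⟨x, ⟨mem_of_mem_nhds hU, hxD⟩, by simpa using hk⟩
  · obtain ⟨u, hu, huD⟩ := mem_closure_iff_nhds.1 (hD.dense hx) _
      (Filter.inter_mem hU ((husc x ⟨hx, hxD⟩).eventually hk))
    exact ⟨u, ⟨hu.1, huD⟩, hu.2 (hD.subset huD)⟩

theorem convex_approxSublevel (hC : IsConvexPointedCone C) (hD : IsSelfSegmentDense D K)
    (hlsc : ∀ x ∈ K, StronglyLSCAt C K F x) (husc : ∀ x ∈ K \ D, StronglyUSCAt C K F x)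
    (hconv : ConeConvexOn C D F) (c : Z) : Convex ℝ (approxSublevel C K F c) := by
  intro x hx y hy a b ha hb hab
  have hzK : a • x + b • y ∈ K := hD.convex hx.1 hy.1 ha hb hab
  refine ⟨hzK, fun k hk => ?_⟩
  -- One third each for moving the endpoints into `D`, for their sublevel bounds, and for lower
  -- semicontinuity at the combination.
  have hk3 := hC.smul_mem_diff (t := 1 / 3) (by norm_num) hk
  have hV := eventually_mem_nhds_iff.2 ((hlsc _ hzK).eventually hk3)
  have hcont : ContinuousAt (fun p : X × X => a • p.1 + b • p.2) (x, y) := by fun_prop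
  have hpre := hcont.preimage_mem_nhds hV
  rw [nhds_prod_eq] at hpre
  obtain ⟨U, hU, W, hW, hUW⟩ := Filter.mem_prod_iff.1 hpre
  obtain ⟨u, hu, hFu⟩ := exists_mem_inter_sub_mem hD husc hx.1 hk3 hU
  obtain ⟨w, hw, hFw⟩ := exists_mem_inter_sub_mem hD husc hy.1 hk3 hW
  have hz := hD.segment_dense u hu.2 w hw.2 ⟨a, b, ha, hb, hab, rfl⟩
  -- Jensen needs the combination itself in `D`, so the weights are perturbed.
  obtain ⟨z, hzV, hzseg, hzD⟩ := mem_closure_iff_nhds.1 hz _ (hUW (mk_mem_prod hu.1 hw.1))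
  obtain ⟨a', b', ha', hb', hab', rfl⟩ := hzseg
  have h1 := hC.smul_mem a' ha' _ (hC.add_mem hFu.1 (hx.2 _ hk3))
  have h2 := hC.smul_mem b' hb' _ (hC.add_mem hFw.1 (hy.2 _ hk3))
  have h3 := hconv.pair hu.2 hw.2 ha' hb' hab' hzD
  convert hC.add_mem (hC.add_mem (hC.add_mem h1 h2) h3) (hzV (hD.subset hzD)).1 using 1
  obtain rfl : b' = 1 - a' := by linarith
  module

/-- Existence of efficient points on bounded closed convex subsets of a reflexive space, for maps
whose approximate sublevel sets are closed and convex. -/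
theorem IsReflexiveBanach.exists_isEfficientPoint (hX : IsReflexiveBanach X)
    (hC : IsConvexPointedCone C) {B : Set X} (hne : (K ∩ B).Nonempty)
    (hB : Bornology.IsBounded B) (hBc : IsClosed B) (hBconv : Convex ℝ B)
    (hcl : ∀ a, IsClosed (approxSublevel C K F a))
    (hconv : ∀ a, Convex ℝ (approxSublevel C K F a)) :
    ∃ x₀, IsEfficientPoint C (K ∩ B) F x₀ := by
  let r : ↥(K ∩ B) → ↥(K ∩ B) → Prop := fun x y => F x - F y ∈ C
  have hrefl : ∀ x, r x x := fun x => by simpa [r] using hC.zero_mem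
  have : Std.Refl r := ⟨hrefl⟩
  have htrans : ∀ {x y z}, r x y → r y z → r x z := fun {x y z} hxy hyz => by
    simpa [r] using hC.add_mem hxy hyz
  have hchain : ∀ c, IsChain r c → ∃ ub, ∀ a ∈ c, r a ub := by
    intro c hc
    by_contra! hub
    obtain ⟨⟨x, hx⟩⟩ := hne.to_subtype
    obtain ⟨i₀, hi₀, -⟩ := hub ⟨x, hx⟩
    have : Nonempty c := ⟨⟨i₀, hi₀⟩⟩
    -- A chain without upper bound has no last element.
    have hlt : ∀ i ∈ c, ∃ j ∈ c, F i - F j ∈ C \ {0} := by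
      intro i hi
      obtain ⟨j, hj, hji⟩ := hub i
      have hij : r i j := (hc.total hi hj).resolve_right hji
      refine ⟨j, hj, hij, fun h => hji ?_⟩
      have h0 : F j - F i = 0 := by rw [← neg_sub, neg_eq_zero]; exact h
      simpa [r, h0] using hC.zero_mem
    have hmono : ∀ i j : ↥(K ∩ B), r i j →
        approxSublevel C K F (F j) ∩ B ⊆ approxSublevel C K F (F i) ∩ B := by
      rintro i j hij u ⟨⟨huK, hu⟩, huB⟩
      refine ⟨⟨huK, fun k hk => ?_⟩, huB⟩
      convert hC.add_mem hij (hu k hk) using 1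
      abel
    obtain ⟨u, hu⟩ := hX.nonempty_iInter_of_directed
      (fun i : c => approxSublevel C K F (F i) ∩ B)
      (fun i j => by
        rcases hc.total i.2 j.2 with h | h
        · exact ⟨j, hmono _ _ h, subset_rfl⟩
        · exact ⟨i, subset_rfl, hmono _ _ h⟩)
      (fun i => ⟨i, ⟨i.1.2.1, fun k hk => by simpa using hk.1⟩, i.1.2.2⟩)
      (fun i => (hconv _).inter hBconv) (fun i => (hcl _).inter hBc)
      (fun i => hB.subset inter_subset_right)
    rw [mem_iInter] at hu
    obtain ⟨i, hi, hiu⟩ := hub ⟨u, (hu ⟨i₀, hi₀⟩).1.1, (hu ⟨i₀, hi₀⟩).2⟩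
    obtain ⟨j, hj, hij⟩ := hlt i hi
    refine hiu ?_
    -- The strict gap `F i - F j` serves as the slack, so the approximate bound at `j` becomes an
    -- exact one at `i`.
    convert (hu ⟨j, hj⟩).1.2 _ hij using 1
    abel
  obtain ⟨m, hm⟩ := exists_maximal_of_chains_bounded hchain htrans
  refine ⟨m, m.2, fun y hy hlt => hlt.2 ?_⟩
  have h1 : r m ⟨y, hy⟩ := by simpa [r] using hlt.1
  exact hC.eq_zero (hm _ h1) (by simpa using hlt.1)

/-- A point of `D` that is efficient near itself is efficient. -/
theorem IsEfficientPoint.of_inter_nhds (hC : IsConvexPointedCone C)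
    (hD : IsSelfSegmentDense D K) (husc : ∀ x ∈ K \ D, StronglyUSCAt C K F x)
    (hconv : ConeConvexOn C D F) {B : Set X} {x : X} (hB : B ∈ 𝓝 x) (hx : x ∈ D)
    (h : IsEfficientPoint C (K ∩ B) F x) : IsEfficientPoint C K F x := by
  refine ⟨h.1.1, fun y hy hlt => ?_⟩
  have hc : F x - F y ∈ C \ {0} :=
    ⟨by simpa using hlt.1, fun h0 => hlt.2 (by rw [← neg_sub, neg_eq_zero.2 h0]; rfl)⟩
  obtain ⟨w, hw, hFw⟩ := exists_mem_inter_sub_mem hD husc hy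
    (hC.smul_mem_diff (t := 1 / 2) (by norm_num) hc) Filter.univ_mem
  have hxw : F x - F w ∈ C \ {0} := by
    convert hC.add_mem_diff hFw.1 (hC.smul_mem_diff (t := 1 / 2) (by norm_num) hc) using 1
    module
  have hne : w ≠ x := fun h0 => hxw.2 (by simp [h0])
  have hcont : ContinuousAt (AffineMap.lineMap x w : ℝ → X) 0 :=
    AffineMap.lineMap_continuous.continuousAt
  have hev : ∀ᶠ t in 𝓝[>] (0 : ℝ), AffineMap.lineMap x w t ∈ interior B :=
    (hcont.eventually_mem (by simpa using interior_mem_nhds.2 hB)).filter_mono nhdsWithin_le_nhds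
  obtain ⟨t, htB, ht0, ht1⟩ :=
    (hev.and (Ioo_mem_nhdsGT (zero_lt_one (α := ℝ)))).exists
  -- Staying away from `x` keeps a positive weight on `w`, which makes the decrease strict.
  have htx : AffineMap.lineMap x w t ≠ x := by
    simp [AffineMap.lineMap_eq_left_iff, hne.symm, ht0.ne']
  have hseg : AffineMap.lineMap x w t ∈ segment ℝ x w := by
    rw [segment_eq_image_lineMap]
    exact ⟨t, ⟨ht0.le, ht1.le⟩, rfl⟩
  obtain ⟨z, ⟨hzB, hzx⟩, hzseg, hzD⟩ := mem_closure_iff_nhds.1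
    (hD.segment_dense x hx w hw.2 hseg) _
    (Filter.inter_mem (isOpen_interior.mem_nhds htB) (isOpen_ne.mem_nhds htx))
  obtain ⟨a, b, ha, hb, hab, rfl⟩ := hzseg
  have hb0 : 0 < b := hb.lt_of_ne fun h0 => hzx (by
    obtain rfl : a = 1 := by linarith
    simp [← h0])
  have hlt' : F x - F (a • x + b • w) ∈ C \ {0} := by
    convert hC.add_mem_diff (hconv.pair hx hw.2 ha hb hab hzD) (hC.smul_mem_diff hb0 hxw) using 1
    obtain rfl : a = 1 - b := by linarith
    module
  refine h.2 _ ⟨hD.subset hzD, interior_subset hzB⟩ ⟨by simpa using hlt'.1, fun h0 => hlt'.2 ?_⟩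
  rw [← neg_sub, mem_singleton_iff.1 h0, neg_zero]
  rfl

end ConeConvex


theorem mainTheorem10
    {X : Type*} [NormedAddCommGroup X] [NormedSpace ℝ X] (hX : IsReflexiveBanach X)
    {Z : Type*} [AddCommGroup Z] [Module ℝ Z] [TopologicalSpace Z] [IsTopologicalAddGroup Z]
    [ContinuousSMul ℝ Z] [LocallyConvexSpace ℝ Z] [T2Space Z]
    (C : Set Z) (hC : IsConvexPointedCone C) (hCint : (interior C).Nonempty)
    (K : Set X) (hKne : K.Nonempty) (hKconv : Convex ℝ K) (hKclosed : IsClosed K)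
    (D : Set X)
    (hD : IsSelfSegmentDense (toWeakSpace ℝ X '' D) (toWeakSpace ℝ X '' K))
    (F : X → Z)
    (hlsc : ∀ x ∈ K, StronglyLSCAt C K F x)
    (husc : ∀ x ∈ K \ D, StronglyUSCAt C K F x)
    (hconv : ConeConvexOn C D F)
    (hcoer : ∃ r : ℝ, 0 < r ∧ (∃ x ∈ K, ‖x‖ ≤ r) ∧
      ∀ x ∈ K, ‖x‖ ≤ r → ∃ y₀ ∈ D, ‖y₀‖ < r ∧ F y₀ - F x ∈ -C) :
    ∃ x₀ : X, IsEfficientPoint C K F x₀ := by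
  obtain ⟨r, -, ⟨x, hxK, hxr⟩, hcoer⟩ := hcoer
  have hD' := hD.of_toWeakSpace
  have hball : ∀ {x : X}, ‖x‖ ≤ r ↔ x ∈ Metric.closedBall (0 : X) r := by simp
  obtain ⟨m, ⟨hmK, hmr⟩, hm⟩ := hX.exists_isEfficientPoint (K := K) (F := F) hC
    ⟨x, hxK, hball.1 hxr⟩ Metric.isBounded_closedBall Metric.isClosed_closedBall
    (convex_closedBall _ _) (isClosed_approxSublevel hC hKclosed hlsc)
    (convex_approxSublevel hC hD' hlsc husc hconv)
  obtain ⟨y, hyD, hyr, hy⟩ := hcoer m hmK (hball.2 hmr)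
  have hyK : y ∈ K ∩ Metric.closedBall (0 : X) r := ⟨hD'.subset hyD, hball.1 hyr.le⟩
  -- `F y` lies below `F m`, so efficiency of `m` on the ball forces equality.
  have heq : F y = F m := by
    by_contra hne
    exact hm y hyK ⟨hy, sub_ne_zero.2 hne⟩
  have hnhds : Metric.closedBall (0 : X) r ∈ 𝓝 y :=
    Metric.closedBall_mem_nhds_of_mem (by simpa using hyr)
  exact ⟨y, IsEfficientPoint.of_inter_nhds hC hD' husc hconv hnhds hyD
    ⟨hyK, fun z hz => by simpa only [heq] using hm z hz⟩⟩
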